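/- Consider the problem $\max\{f(S) : S\subseteq N,\ |S|\le B\}$, where $N$ is a finite non-empty ground set, $B$ is a positive integer, and $f\colon 2^N\to\mathbb{R}_{\ge 0}$ is a non-negative monotone submodular function that is accessed through a value oracle (a query is a set $Q\subseteq N$ and its answer is $f(Q)$). The density of the constraint is $B/|N|$. A (possibly randomized, adaptive) algorithm guarantees an $(\alpha,\beta)$-bicriteria approximation for the instances of density $c$ if on every such instance it outputs a set $S$ such that $|S|\le \beta B$ (almost surely) and $\mathbb{E}[f(S)]\ge \alpha\cdot\max_{|T|\le B} f(T)$. It uses a sub-exponential number of value oracle queries if there is a function $q(n)=2^{o(n)}$ such that on every instance of density $c$ with $|N|=n$ it makes (almost surely) at most $q(n)$ queries; no restriction is placed on its other computations. For $c\in(0,1)$ and $\varepsilon\in(0,1)$ let $$\rho(c,\varepsilon)=\begin{cases}\dfrac{1-\varepsilon^{c}}{c} & \text{if } c\le 1/2,\\[2mm] \dfrac{1-2(1-c)\sqrt{\varepsilon}-\varepsilon(2c-1)}{c} & \text{if } c\ge 1/2.\end{cases}$$ **Theorem.** For every rational constant $c\in(0,1)$ and every two constants $\varepsilon\in(0,1)$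 and $\delta\in(0,\varepsilon]$, no algorithm that uses a sub-exponential number of value oracle queries guarantees a $(1-\varepsilon+\delta,\ \rho(c,\varepsilon))$-bicriteria approximation for the problem of maximizing a non-negative monotone submodular function subject to a cardinality constraint of density $c$. -/

import Mathlib

open MeasureTheory Filter

noncomputable section

/-- A set function on the subsets of `α` is submodular. -/
def IsSubmodular {α : Type*} [DecidableEq α] (f : Finset α → ℝ) : Prop :=
  ∀ S T : Finset α, f (S ∪ T) + f (S ∩ T) ≤ f S + f T

/-- The objective functions of the problem: non-negative monotone submodular set functions. -/
structure IsObjective {α : Type*} [DecidableEq α] (f : Finset α → ℝ) : Prop where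
  nonneg : ∀ S, 0 ≤ f S
  mono : Monotone f
  submodular : IsSubmodular f

/-- The value `max {f T : |T| ≤ B}` of an optimal solution under the cardinality constraint with
budget `B`. -/
def optValue {α : Type*} [Fintype α] (f : Finset α → ℝ) (B : ℕ) : ℝ :=
  (Finset.univ.filter fun T : Finset α => T.card ≤ B).sup' ⟨∅, by simp⟩ f

/-- The infeasibility ratio of the set `S` under the cardinality constraint with budget `B` is at
most `β`, i.e., `|S| ≤ β * B`. -/
def HasInfeasibilityRatio {α : Type*} (B : ℕ) (S : Finset α) (β : ℝ) : Prop :=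
  (S.card : ℝ) ≤ β * B

/-- The convex hull of the characteristic vectors of the sets of size at most `B`. -/
def cardinalityPolytope (α : Type*) [DecidableEq α] (B : ℕ) : Set (α → ℝ) :=
  convexHull ℝ {x | ∃ T : Finset α, T.card ≤ B ∧ x = fun u => if u ∈ T then 1 else 0}

/-- If the characteristic vector of `S` is at most `β` times a point of the convex hull of the
feasible sets, then `|S| ≤ β * B`. (The converse holds for `β ≥ 1`; for `β < 1` the hull condition
is satisfied by the empty set only, so the bound on `|S|` is the meaningful, less restrictive
condition.) -/
theorem hasInfeasibilityRatio_of_polytope {α : Type*} [Fintype α] [DecidableEq α] {B : ℕ}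
    {S : Finset α} {β : ℝ} (hβ : 0 ≤ β) {y : α → ℝ} (hy : y ∈ cardinalityPolytope α B)
    (hS : ∀ u, (if u ∈ S then 1 else 0 : ℝ) ≤ β * y u) : HasInfeasibilityRatio B S β := by
  have hsub : cardinalityPolytope α B ⊆ {x : α → ℝ | ∑ u, x u ≤ (B : ℝ)} := by
    apply convexHull_min
    · rintro x ⟨T, hT, rfl⟩
      simpa using hT
    · intro x hx z hz a b ha hb hab
      simp only [Set.mem_ofPred_eq, Pi.add_apply, Pi.smul_apply, smul_eq_mul,
        Finset.sum_add_distrib, ← Finset.mul_sum] at *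
      calc a * ∑ u, x u + b * ∑ u, z u ≤ a * B + b * B := by gcongr
        _ = B := by rw [← add_mul, hab, one_mul]
  have h1 : (∑ u, (if u ∈ S then 1 else 0 : ℝ)) ≤ ∑ u, β * y u :=
    Finset.sum_le_sum fun u _ => hS u
  rw [← Finset.mul_sum] at h1
  have h2 : (S.card : ℝ) = ∑ u, (if u ∈ S then 1 else 0 : ℝ) := by simp
  unfold HasInfeasibilityRatio
  rw [h2]
  exact h1.trans (mul_le_mul_of_nonneg_left (hsub hy) hβ)

/-- A deterministic adaptive algorithm with access to a value oracle for a set function on `α`,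
as a decision tree with unrestricted computational power: it either stops and outputs a set, or
queries the value of a set and continues in a way that depends on the answer. -/
inductive OracleTree (α : Type*) where
  | done (S : Finset α) : OracleTree α
  | query (Q : Finset α) (next : ℝ → OracleTree α) : OracleTree α

/-- The set that the algorithm outputs when the oracle is `f`. -/
def OracleTree.output {α : Type*} (f : Finset α → ℝ) : OracleTree α → Finset α
  | .done S => S
  | .query Q next => (next (f Q)).output f

/-- The number of queries that the algorithm makes when the oracle is `f`. -/
def OracleTree.queryCount {α : Type*} (f : Finset α → ℝ) : OracleTree α → ℕ
  | .done _ => 0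
  | .query Q next => (next (f Q)).queryCount f + 1

/-- A randomized algorithm with random source `Ω`: given the size `n` of the ground set `Fin n`,
the budget `B` and the outcome `ω` of the random source, it runs a deterministic value-oracle
algorithm. For every oracle, the output is a random set. -/
structure RandomizedAlgorithm (Ω : Type*) [MeasurableSpace Ω] where
  run : (n B : ℕ) → Ω → OracleTree (Fin n)
  measurable_output : ∀ (n B : ℕ) (f : Finset (Fin n) → ℝ) (S : Finset (Fin n)),
    MeasurableSet {ω | (run n B ω).output f = S}

/-- `q n = exp (o(n))`. -/
def IsSubexponential (q : ℕ → ℕ) : Prop :=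
  ∀ κ : ℝ, 0 < κ → ∀ᶠ n : ℕ in atTop, (q n : ℝ) ≤ Real.exp (κ * n)

namespace RandomizedAlgorithm

variable {Ω : Type*} [MeasurableSpace Ω]

/-- On all instances whose cardinality constraint has density `B / n = c`, the number of value
oracle queries is bounded by a sub-exponential function of the size of the ground set. -/
def UsesSubexponentiallyManyQueries (A : RandomizedAlgorithm Ω) (P : Measure Ω) (c : ℚ) : Prop :=
  ∃ q : ℕ → ℕ, IsSubexponential q ∧
    ∀ (n B : ℕ), (B : ℚ) / n = c → ∀ f : Finset (Fin n) → ℝ, IsObjective f →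
      ∀ᵐ ω ∂P, (A.run n B ω).queryCount f ≤ q n

/-- On all instances whose cardinality constraint has density `B / n = c`, the output has an
infeasibility ratio of at most `β`, and its expected value is at least `α` times the value of an
optimal (feasible) solution. -/
def GuaranteesBicriteria (A : RandomizedAlgorithm Ω) (P : Measure Ω) (c : ℚ) (α β : ℝ) : Prop :=
  ∀ (n B : ℕ), (B : ℚ) / n = c → ∀ f : Finset (Fin n) → ℝ, IsObjective f →
    (∀ᵐ ω ∂P, HasInfeasibilityRatio B ((A.run n B ω).output f) β) ∧
      α * optValue f B ≤ ∫ ω, f ((A.run n B ω).output f) ∂P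

end RandomizedAlgorithm

/-- The function `ρ(c, ε)`. -/
def rho (c ε : ℝ) : ℝ :=
  if c ≤ 1 / 2 then (1 - ε ^ c) / c
  else (1 - 2 * (1 - c) * Real.sqrt ε - ε * (2 * c - 1)) / c

end

/-!
The hardness comes from a hidden set that a few queries cannot locate. The ground set is split into
a known part `M` and its complement `L`. Inside `M` a random set `A` of a fraction `p ≤ 1 / 2` of the
elements of `M` is hidden, and `A ∪ L` is a feasible set. With `u` and `v` the fractions of `A` and
of `M \ A` that a set `S` misses, one would like to use the objective
`w * (1 - u * v ^ ((1 - p) / p)) + ν * |S ∩ L|`, which is `1` at `S = A ∪ L`. At points with `u = v`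
the gradient of `u * v ^ ((1 - p) / p)` is proportional to `(p, 1 - p)`, that is, to the gradient of
the fraction `t = p * u + (1 - p) * v` of `M` that `S` misses. Hence this function can be glued in a
continuously differentiable way to `t ^ (1 / p)`, which depends on `|S ∩ M|` only: shift `u` and `v`
towards each other where `v - u ≥ η`, and use `t ^ (1 / p)` where `v - u ≤ η`. The result is
`profile`. Its gradient is nonnegative and monotone in both coordinates, so `hardFun` is monotone and
submodular (`isObjective_hardFun`); it is at least `1 - η` at `A ∪ L` (`one_sub_le_hardFun`), and it
does not depend on `A` at sets with `v - u ≤ η` (`hardFun_of_balanced`).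

To hide `A`, cut `M` into `k` blocks of constant size `m`, identify each block with `ZMod m`, and
take an independent random cyclic shift of an interval of `a` elements in each block. By a Hoeffding
bound a fixed set has `v - u > η` with probability exponentially small in `k`
(`card_unbalanced_le`). So for all but a vanishing fraction of the hidden sets an algorithm with
subexponentially many queries behaves as on the common function of the balanced sets and returns a
set on which the two functions agree (`OracleTree.card_distinguished_le`); on average over the hidden
sets its value is therefore essentially at most the largest value of the common function on sets of
the permitted size (`RandomizedAlgorithm.le_of_guaranteesBicriteria`).

For `c ≤ 1 / 2` take `M` to be everything and `p = c`: a set of size `|S| ≤ (1 - ε ^ c) * n` has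
`t ≥ ε ^ c`, hence value at most `1 - ε`. For `c > 1 / 2` take `|M| = 2 * (1 - c) * n`, `p = 1 / 2`
and a weight `w` for which, at `t = √ε`, the common function gains equally from an element of `M` and
from an element of `L`; being concave, it is then bounded by a tangent that is linear in `|S|`, and
the bound at `|S| = ρ(c, ε) * B` is exactly `1 - ε`.
-/

/-! ### A continuously differentiable profile with monotone gradient -/

/-- The function of the missed fractions `u` of the hidden set and `v` of the rest of `M`. With
`t = p * u + (1 - p) * v` it is `t ^ (1 / p)` where `v - u ≤ η`, and
`(u + (1 - p) * η) * (v - p * η) ^ ((1 - p) / p)` where `v - u ≥ η`. Both cases are products of the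
form `U * V ^ ((1 - p) / p)`, with `U` the minimum and `V` the maximum below. -/
noncomputable def profile (p η u v : ℝ) : ℝ :=
  min (p * u + (1 - p) * v) (u + (1 - p) * η) *
    max (p * u + (1 - p) * v) (v - p * η) ^ ((1 - p) / p)

/-- Two functions that agree to first order at `x` may be glued along an arbitrary set. -/
theorem hasDerivAt_of_eq_or_eq {f g h : ℝ → ℝ} {d x : ℝ} (hf : HasDerivAt f d x)
    (hg : HasDerivAt g d x) (hfx : h x = f x) (hgx : h x = g x)
    (hh : ∀ y, h y = f y ∨ h y = g y) : HasDerivAt h d x := by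
  rw [hasDerivAt_iff_isLittleO] at hf hg ⊢
  rw [Asymptotics.isLittleO_iff] at hf hg ⊢
  intro C hC
  filter_upwards [hf hC, hg hC] with y hy1 hy2
  rcases hh y with h1 | h1
  · rw [h1, hfx]; exact hy1
  · rw [h1, hgx]; exact hy2

theorem hasDerivAt_mul_rpow {U V : ℝ → ℝ} {U' V' γ x : ℝ} (hγ : 1 ≤ γ) (hU : HasDerivAt U U' x)
    (hV : HasDerivAt V V' x) :
    HasDerivAt (fun y => U y * V y ^ γ) (V x ^ γ * U' + γ * U x * V x ^ (γ - 1) * V') x := by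
  refine (hU.mul (hV.rpow_const (Or.inr hγ))).congr_deriv ?_
  ring

/-- The derivative of `profile` along a line: with `U` and `V` the minimum and the maximum in the
definition and `γ = (1 - p) / p`, its gradient is `(V ^ γ, γ * U * V ^ (γ - 1))`. On the line
`v - u = η` both pieces have this gradient. -/
theorem hasDerivAt_profile {p η u v e₁ e₂ x : ℝ} (hp0 : 0 < p) (hp : p ≤ 1 / 2)
    (ht : 0 ≤ p * (u + x * e₁) + (1 - p) * (v + x * e₂)) :
    HasDerivAt (fun y => profile p η (u + y * e₁) (v + y * e₂))
      (max (p * (u + x * e₁) + (1 - p) * (v + x * e₂)) (v + x * e₂ - p * η) ^ ((1 - p) / p) * e₁ +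
        (1 - p) / p * min (p * (u + x * e₁) + (1 - p) * (v + x * e₂)) (u + x * e₁ + (1 - p) * η) *
          max (p * (u + x * e₁) + (1 - p) * (v + x * e₂)) (v + x * e₂ - p * η) ^
            ((1 - p) / p - 1) * e₂) x := by
  have hγ : 1 ≤ (1 - p) / p := by rw [le_div_iff₀ hp0]; linarith
  have hpγ : p * ((1 - p) / p) = 1 - p := by field_simp
  set γ := (1 - p) / p with hγdef
  have hu : HasDerivAt (fun y : ℝ => u + y * e₁) e₁ x := by
    simpa using ((hasDerivAt_id x).mul_const e₁).const_add u
  have hv : HasDerivAt (fun y : ℝ => v + y * e₂) e₂ x := by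
    simpa using ((hasDerivAt_id x).mul_const e₂).const_add v
  have htd : HasDerivAt (fun y : ℝ => p * (u + y * e₁) + (1 - p) * (v + y * e₂))
      (p * e₁ + (1 - p) * e₂) x := (hu.const_mul p).add (hv.const_mul (1 - p))
  have hmin : ∀ y, v + y * e₂ - (u + y * e₁) ≤ η →
      profile p η (u + y * e₁) (v + y * e₂) = (p * (u + y * e₁) + (1 - p) * (v + y * e₂)) *
        (p * (u + y * e₁) + (1 - p) * (v + y * e₂)) ^ γ := by
    intro y hy
    rw [profile, min_eq_left (by nlinarith), max_eq_left (by nlinarith)]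
  have hmax : ∀ y, η ≤ v + y * e₂ - (u + y * e₁) →
      profile p η (u + y * e₁) (v + y * e₂) = (u + y * e₁ + (1 - p) * η) *
        (v + y * e₂ - p * η) ^ γ := by
    intro y hy
    rw [profile, min_eq_right (by nlinarith), max_eq_right (by nlinarith)]
  have hd1 : HasDerivAt (fun y => (p * (u + y * e₁) + (1 - p) * (v + y * e₂)) *
        (p * (u + y * e₁) + (1 - p) * (v + y * e₂)) ^ γ)
      ((p * (u + x * e₁) + (1 - p) * (v + x * e₂)) ^ γ * e₁ +
        γ * (p * (u + x * e₁) + (1 - p) * (v + x * e₂)) *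
          (p * (u + x * e₁) + (1 - p) * (v + x * e₂)) ^ (γ - 1) * e₂) x := by
    refine (hasDerivAt_mul_rpow hγ htd htd).congr_deriv ?_
    generalize p * (u + x * e₁) + (1 - p) * (v + x * e₂) = t at ht
    have h1 : t ^ γ = t * t ^ (γ - 1) := by
      rcases ht.eq_or_lt with h0 | h0
      · rw [← h0, Real.zero_rpow (by linarith), zero_mul]
      · rw [Real.rpow_sub_one h0.ne']; field_simp
    rw [h1]
    have h2 : p * γ + p = 1 := by linarith
    clear_value γ
    linear_combination (t * t ^ (γ - 1)) * (e₁ - e₂) * h2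
  have hd2 : HasDerivAt (fun y => (u + y * e₁ + (1 - p) * η) * (v + y * e₂ - p * η) ^ γ)
      ((v + x * e₂ - p * η) ^ γ * e₁ +
        γ * (u + x * e₁ + (1 - p) * η) * (v + x * e₂ - p * η) ^ (γ - 1) * e₂) x :=
    hasDerivAt_mul_rpow hγ (hu.add_const _) (hv.sub_const _)
  rcases lt_trichotomy (v + x * e₂ - (u + x * e₁)) η with h | h | h
  · rw [min_eq_left (by nlinarith), max_eq_left (by nlinarith)]
    refine hd1.congr_of_eventuallyEq ?_
    filter_upwards [(hv.sub hu).continuousAt.eventually (gt_mem_nhds h)] with y hy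
    exact hmin y hy.le
  · have e1 : v + x * e₂ - p * η = p * (u + x * e₁) + (1 - p) * (v + x * e₂) := by
      rw [← h]; ring
    have e2 : u + x * e₁ + (1 - p) * η = p * (u + x * e₁) + (1 - p) * (v + x * e₂) := by
      rw [← h]; ring
    rw [e1, e2] at hd2 ⊢
    rw [min_self, max_self]
    refine hasDerivAt_of_eq_or_eq hd1 hd2 (hmin x h.le) (hmax x h.ge) fun y => ?_
    exact (le_total _ η).imp (hmin y) (hmax y)
  · rw [min_eq_right (by nlinarith), max_eq_right (by nlinarith)]
    refine hd2.congr_of_eventuallyEq ?_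
    filter_upwards [(hv.sub hu).continuousAt.eventually (lt_mem_nhds h)] with y hy
    exact hmax y hy.le

theorem convexComb_mono {p u v u' v' : ℝ} (hp0 : 0 ≤ p) (hp1 : p ≤ 1) (hu : u ≤ u') (hv : v ≤ v') :
    p * u + (1 - p) * v ≤ p * u' + (1 - p) * v' := by
  have := sub_nonneg.2 hp1
  gcongr

theorem convexComb_nonneg {p u v : ℝ} (hp0 : 0 ≤ p) (hp1 : p ≤ 1) (hu : 0 ≤ u) (hv : 0 ≤ v) :
    0 ≤ p * u + (1 - p) * v := by
  have := sub_nonneg.2 hp1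
  positivity

/-- Increasing differences: the gradient of `profile` is monotone, so its increment along a fixed
nonnegative vector grows with the base point. -/
theorem profile_add_sub_le {p η u v u' v' e₁ e₂ : ℝ} (hp0 : 0 < p) (hp : p ≤ 1 / 2) (hη : 0 ≤ η)
    (hu : 0 ≤ u) (hv : 0 ≤ v) (huu : u ≤ u') (hvv : v ≤ v') (he₁ : 0 ≤ e₁) (he₂ : 0 ≤ e₂) :
    profile p η (u + e₁) (v + e₂) - profile p η u v ≤
      profile p η (u' + e₁) (v' + e₂) - profile p η u' v' := by
  have hp1 : 0 ≤ 1 - p := by linarith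
  have hγ : 1 ≤ (1 - p) / p := by rw [le_div_iff₀ hp0]; linarith
  have key : ∀ {u v : ℝ}, 0 ≤ u → 0 ≤ v → ∀ x ∈ Set.Icc (0 : ℝ) 1,
      0 ≤ p * (u + x * e₁) + (1 - p) * (v + x * e₂) := fun hu hv x hx =>
    convexComb_nonneg hp0.le (by linarith) (add_nonneg hu (mul_nonneg hx.1 he₁))
      (add_nonneg hv (mul_nonneg hx.1 he₂))
  have hd : ∀ x ∈ Set.Icc (0 : ℝ) 1, HasDerivAt (fun y =>
      profile p η (u' + y * e₁) (v' + y * e₂) - profile p η (u + y * e₁) (v + y * e₂)) _ x :=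
    fun x hx => (hasDerivAt_profile hp0 hp (key (hu.trans huu) (hv.trans hvv) x hx)).sub
      (hasDerivAt_profile hp0 hp (key hu hv x hx))
  have hmono := monotoneOn_of_deriv_nonneg (convex_Icc (0 : ℝ) 1)
    (fun x hx => (hd x hx).continuousAt.continuousWithinAt)
    (fun x hx => (hd x (interior_subset hx)).differentiableAt.differentiableWithinAt) ?_
  · have := hmono (Set.left_mem_Icc.2 zero_le_one) (Set.right_mem_Icc.2 zero_le_one) zero_le_one
    simp only [zero_mul, one_mul, add_zero] at this
    linarith
  · intro x hx
    replace hx := interior_subset hx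
    rw [(hd x hx).deriv, sub_nonneg]
    have h1 : u + x * e₁ ≤ u' + x * e₁ := by linarith
    have h2 : v + x * e₂ ≤ v' + x * e₂ := by linarith
    have h3 := convexComb_mono hp0.le (by linarith) h1 h2
    have h4 := key hu hv x hx
    have h5 : 0 ≤ u + x * e₁ := add_nonneg hu (mul_nonneg hx.1 he₁)
    have h6 : 0 ≤ (1 - p) / p * min (p * (u' + x * e₁) + (1 - p) * (v' + x * e₂))
        (u' + x * e₁ + (1 - p) * η) :=
      mul_nonneg (by linarith) (le_min (h4.trans h3) (by nlinarith))
    have h7 := h4.trans (le_max_left _ (v + x * e₂ - p * η))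
    have h8 := sub_nonneg.2 hγ
    gcongr

theorem profile_mono {p η u v u' v' : ℝ} (hp0 : 0 < p) (hp : p ≤ 1 / 2) (hη : 0 ≤ η)
    (hu : 0 ≤ u) (hv : 0 ≤ v) (huu : u ≤ u') (hvv : v ≤ v') :
    profile p η u v ≤ profile p η u' v' := by
  have hγ : 0 ≤ (1 - p) / p := div_nonneg (by linarith) hp0.le
  have h3 := convexComb_mono hp0.le (by linarith) huu hvv
  have h4 := convexComb_nonneg hp0.le (by linarith) hu hv
  have h5 : 0 ≤ min (p * u' + (1 - p) * v') (u' + (1 - p) * η) :=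
    le_min (h4.trans h3) (by nlinarith)
  have h6 := h4.trans (le_max_left _ (v - p * η))
  unfold profile
  gcongr

theorem profile_nonneg {p η u v : ℝ} (hp0 : 0 < p) (hp : p ≤ 1 / 2) (hη : 0 ≤ η)
    (hu : 0 ≤ u) (hv : 0 ≤ v) : 0 ≤ profile p η u v := by
  have h4 := convexComb_nonneg hp0.le (by linarith) hu hv
  exact mul_nonneg (le_min h4 (by nlinarith)) (Real.rpow_nonneg (h4.trans (le_max_left _ _)) _)

theorem profile_of_sub_le {p η u v : ℝ} (hp0 : 0 ≤ p) (hp1 : p ≤ 1) (h : v - u ≤ η) :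
    profile p η u v =
      (p * u + (1 - p) * v) * (p * u + (1 - p) * v) ^ ((1 - p) / p) := by
  rw [profile, min_eq_left (by nlinarith), max_eq_left (by nlinarith)]

theorem profile_le_one {p η u v : ℝ} (hp0 : 0 < p) (hp : p ≤ 1 / 2) (hη : 0 ≤ η)
    (hu : 0 ≤ u) (hv : 0 ≤ v) (hu1 : u ≤ 1) (hv1 : v ≤ 1) : profile p η u v ≤ 1 := by
  refine (profile_mono hp0 hp hη hu hv hu1 hv1).trans ?_
  rw [profile_of_sub_le hp0.le (by linarith) (by simpa using hη)]
  simp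

theorem profile_zero_one_le {p η : ℝ} (hp0 : 0 < p) (hp : p ≤ 1 / 2) (hη : 0 ≤ η) :
    profile p η 0 1 ≤ η := by
  have hγ : 0 ≤ (1 - p) / p := div_nonneg (by linarith) hp0.le
  have h1 : max (p * 0 + (1 - p) * 1) (1 - p * η) ^ ((1 - p) / p) ≤ 1 :=
    Real.rpow_le_one (le_max_of_le_left (by linarith))
      (max_le (by linarith) (by nlinarith)) hγ
  have h2 : min (p * 0 + (1 - p) * 1) (0 + (1 - p) * η) ≤ η :=
    (min_le_right _ _).trans (by nlinarith)
  calc profile p η 0 1 ≤ η * 1 := mul_le_mul h2 h1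
        (Real.rpow_nonneg (le_max_of_le_left (by linarith)) _) hη
    _ = η := mul_one η

/-! ### The objective functions with a hidden set -/

/-- The fraction of the elements of `X` that `S` misses (equal to `1` if `X` is empty). -/
noncomputable def deficit {α : Type*} [DecidableEq α] (X S : Finset α) : ℝ :=
  1 - ((S ∩ X).card : ℝ) / X.card

section
variable {α : Type*} [DecidableEq α]

theorem deficit_nonneg (X S : Finset α) : 0 ≤ deficit X S :=
  sub_nonneg.2 (div_le_one_of_le₀ (by exact_mod_cast Finset.card_le_card Finset.inter_subset_right)
    (Nat.cast_nonneg _))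

theorem deficit_le_one (X S : Finset α) : deficit X S ≤ 1 :=
  sub_le_self _ (by positivity)

theorem deficit_anti (X : Finset α) {S T : Finset α} (h : S ⊆ T) : deficit X T ≤ deficit X S := by
  unfold deficit
  gcongr

theorem card_union_inter_add_card_inter_inter (X S T : Finset α) :
    ((S ∪ T) ∩ X).card + ((S ∩ T) ∩ X).card = (S ∩ X).card + (T ∩ X).card := by
  rw [Finset.union_inter_distrib_right, Finset.inter_inter_distrib_right,
    Finset.card_union_add_card_inter]

theorem deficit_union_add_deficit_inter (X S T : Finset α) :
    deficit X (S ∪ T) + deficit X (S ∩ T) = deficit X S + deficit X T := by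
  have h : (((S ∪ T) ∩ X).card : ℝ) + ((S ∩ T) ∩ X).card = (S ∩ X).card + (T ∩ X).card := by
    exact_mod_cast card_union_inter_add_card_inter_inter X S T
  unfold deficit
  linear_combination (-1 / (X.card : ℝ)) * h

/-- The objective function with hidden set `A ⊆ M`: weight `w` on the `profile` term inside `M`, and
`ν` for every element of `L`. -/
noncomputable def hardFun (p η w ν : ℝ) (M A L S : Finset α) : ℝ :=
  w * (1 - profile p η (deficit A S) (deficit (M \ A) S)) + ν * (S ∩ L).card

variable {p η w ν : ℝ}

theorem isObjective_hardFun (hp0 : 0 < p) (hp : p ≤ 1 / 2) (hη : 0 ≤ η) (hw : 0 ≤ w) (hν : 0 ≤ ν)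
    (M A L : Finset α) : IsObjective (hardFun p η w ν M A L) where
  nonneg S := by
    have := profile_le_one hp0 hp hη (deficit_nonneg A S) (deficit_nonneg (M \ A) S)
      (deficit_le_one A S) (deficit_le_one (M \ A) S)
    exact add_nonneg (mul_nonneg hw (sub_nonneg.2 this)) (by positivity)
  mono S T h := by
    have := profile_mono hp0 hp hη (deficit_nonneg A T) (deficit_nonneg (M \ A) T)
      (deficit_anti A h) (deficit_anti (M \ A) h)
    unfold hardFun
    gcongr
  submodular S T := by
    have hA := deficit_union_add_deficit_inter A S T
    have hD := deficit_union_add_deficit_inter (M \ A) S T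
    have hL : (((S ∪ T) ∩ L).card : ℝ) + ((S ∩ T) ∩ L).card = (S ∩ L).card + (T ∩ L).card := by
      exact_mod_cast card_union_inter_add_card_inter_inter L S T
    have hS : S ⊆ S ∪ T := Finset.subset_union_left
    have hT : T ⊆ S ∪ T := Finset.subset_union_right
    have := profile_add_sub_le hp0 hp hη (deficit_nonneg A (S ∪ T))
      (deficit_nonneg (M \ A) (S ∪ T)) (deficit_anti A hS) (deficit_anti (M \ A) hS)
      (sub_nonneg.2 (deficit_anti A hT)) (sub_nonneg.2 (deficit_anti (M \ A) hT))
    have eA : deficit A S + (deficit A T - deficit A (S ∪ T)) = deficit A (S ∩ T) := by linarith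
    have eD : deficit (M \ A) S + (deficit (M \ A) T - deficit (M \ A) (S ∪ T)) =
      deficit (M \ A) (S ∩ T) := by linarith
    rw [add_sub_cancel, add_sub_cancel, eA, eD] at this
    have h2 := mul_le_mul_of_nonneg_left this hw
    unfold hardFun
    linear_combination h2 + ν * hL

theorem hardFun_le_one (hp0 : 0 < p) (hp : p ≤ 1 / 2) (hη : 0 ≤ η) (hw : 0 ≤ w) (hν : 0 ≤ ν)
    {M A L : Finset α} (hL : ν * L.card = 1 - w) (S : Finset α) :
    hardFun p η w ν M A L S ≤ 1 := by
  have h1 := profile_nonneg hp0 hp hη (deficit_nonneg A S) (deficit_nonneg (M \ A) S)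
  have h2 : ν * ((S ∩ L).card : ℝ) ≤ ν * L.card := by gcongr; exact Finset.inter_subset_right
  have h3 := mul_nonneg hw h1
  unfold hardFun
  linarith

/-- The set `A ∪ L` misses nothing of `A` and all of `M \ A`, where `profile p η 0 1 ≤ η`. -/
theorem one_sub_le_hardFun (hp0 : 0 < p) (hp : p ≤ 1 / 2) (hη : 0 ≤ η) (hw : 0 ≤ w) (hw1 : w ≤ 1)
    {M A L : Finset α} (hL : ν * L.card = 1 - w) (hML : Disjoint M L) (hA : A.Nonempty) :
    1 - η ≤ hardFun p η w ν M A L (A ∪ L) := by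
  have e1 : deficit A (A ∪ L) = 0 := by
    rw [deficit, Finset.inter_eq_right.2 Finset.subset_union_left, div_self, sub_self]
    exact_mod_cast hA.card_pos.ne'
  have e2 : deficit (M \ A) (A ∪ L) = 1 := by
    have : (A ∪ L) ∩ (M \ A) = ∅ := by
      ext x
      have : x ∈ M → x ∉ L := fun h => Finset.disjoint_left.1 hML h
      simp only [Finset.mem_inter, Finset.mem_union, Finset.mem_sdiff, Finset.notMem_empty]
      tauto
    simp [deficit, this]
  rw [hardFun, e1, e2, Finset.inter_eq_right.2 Finset.subset_union_right, hL]
  nlinarith [profile_zero_one_le hp0 hp hη]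

theorem convexComb_deficit {M A : Finset α} (hAM : A ⊆ M) (hA : A.Nonempty) (hAM' : (M \ A).Nonempty)
    (hp : p * M.card = A.card) (S : Finset α) :
    p * deficit A S + (1 - p) * deficit (M \ A) S = deficit M S := by
  have h1 : (A.card : ℝ) + (M \ A).card = M.card := by
    have := Finset.card_sdiff_add_card_eq_card hAM
    rw [add_comm]; exact_mod_cast this
  have h2 : ((S ∩ A).card : ℝ) + (S ∩ (M \ A)).card = (S ∩ M).card := by
    have h := Finset.card_union_of_disjoint (s := S ∩ A) (t := S ∩ (M \ A))
      (Finset.disjoint_sdiff.mono Finset.inter_subset_right Finset.inter_subset_right)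
    rw [← Finset.inter_union_distrib_left, Finset.union_sdiff_of_subset hAM] at h
    exact_mod_cast h.symm
  have h3 : (0 : ℝ) < A.card := by exact_mod_cast hA.card_pos
  have h4 : (0 : ℝ) < (M \ A).card := by exact_mod_cast hAM'.card_pos
  have h5 : (0 : ℝ) < M.card := by linarith
  have h6 : p = A.card / M.card := by field_simp; exact hp
  have h7 : 1 - p = (M \ A).card / M.card := by
    rw [h6, eq_div_iff h5.ne']; field_simp; linarith
  rw [h7, h6]
  unfold deficit
  field_simp
  rw [← h2, ← h1]
  ring

/-- On balanced sets the objective function depends on `M` and `L` only, not on the hidden set. -/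
theorem hardFun_of_balanced (hp0 : 0 < p) (hp : p ≤ 1 / 2) {M A L S : Finset α} (hAM : A ⊆ M)
    (hA : A.Nonempty) (hAM' : (M \ A).Nonempty) (hpM : p * M.card = A.card)
    (h : deficit (M \ A) S - deficit A S ≤ η) :
    hardFun p η w ν M A L S =
      w * (1 - deficit M S * deficit M S ^ ((1 - p) / p)) + ν * (S ∩ L).card := by
  rw [hardFun, profile_of_sub_le hp0.le (by linarith) h, convexComb_deficit hAM hA hAM' hpM]

end

/-! ### Cyclically shifted hidden sets and a Hoeffding bound -/

theorem exp_le_exp_add_sq {x : ℝ} (hx : |x| ≤ 1) : Real.exp x ≤ x + Real.exp (x ^ 2) := by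
  have h1 := (abs_le.1 (Real.abs_exp_sub_one_sub_id_le hx)).2
  have h2 := Real.add_one_le_exp (x ^ 2)
  linarith

/-- A Hoeffding bound, in counting form, for a sum of independent centred variables `Z b`, each
uniform on the values `Z b s` and bounded by `D`. -/
theorem card_lt_sum_le {ι σ : Type*} [Fintype ι] [DecidableEq ι] [Fintype σ] {Z : ι → σ → ℝ}
    {D θ : ℝ} (hD : 0 < D) (hθ : 0 ≤ θ) (hθD : θ ≤ 2 * D) (hZ : ∀ b, ∑ s, Z b s = 0)
    (hZD : ∀ b s, |Z b s| ≤ D) :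
    (((Finset.univ : Finset (ι → σ)).filter fun φ =>
      θ * Fintype.card ι < ∑ b, Z b (φ b)).card : ℝ) ≤
      Real.exp (-(θ ^ 2 / (4 * D ^ 2)) * Fintype.card ι) * Fintype.card (ι → σ) := by
  -- The minimizer of the exponent `l ^ 2 * D ^ 2 - l * θ` of the Chernoff bound below.
  set l : ℝ := θ / (2 * D ^ 2) with hl
  have hl0 : 0 ≤ l := by positivity
  have hlD : l * D ≤ 1 := by
    rw [hl, div_mul_eq_mul_div, div_le_one (by positivity)]; nlinarith
  have key : ∀ b, ∑ s, Real.exp (l * Z b s) ≤ Fintype.card σ * Real.exp (l ^ 2 * D ^ 2) := by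
    intro b
    calc ∑ s, Real.exp (l * Z b s) ≤ ∑ s, (l * Z b s + Real.exp (l ^ 2 * D ^ 2)) := by
          refine Finset.sum_le_sum fun s _ => ?_
          have h1 : |l * Z b s| ≤ l * D := by
            rw [abs_mul, abs_of_nonneg hl0]; exact mul_le_mul_of_nonneg_left (hZD b s) hl0
          refine (exp_le_exp_add_sq (h1.trans hlD)).trans ?_
          gcongr
          rw [← mul_pow, ← sq_abs]
          gcongr
      _ = _ := by
          rw [Finset.sum_add_distrib, ← Finset.mul_sum, hZ]; simp
  have h1 : (((Finset.univ : Finset (ι → σ)).filter fun φ =>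
      θ * Fintype.card ι < ∑ b, Z b (φ b)).card : ℝ) * Real.exp (l * (θ * Fintype.card ι)) ≤
      Fintype.card (ι → σ) * Real.exp (l ^ 2 * D ^ 2 * Fintype.card ι) := by
    calc _ = ∑ φ ∈ (Finset.univ : Finset (ι → σ)).filter fun φ =>
              θ * Fintype.card ι < ∑ b, Z b (φ b), Real.exp (l * (θ * Fintype.card ι)) := by simp
      _ ≤ ∑ φ ∈ (Finset.univ : Finset (ι → σ)).filter fun φ =>
              θ * Fintype.card ι < ∑ b, Z b (φ b), Real.exp (l * ∑ b, Z b (φ b)) := by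
          refine Finset.sum_le_sum fun φ hφ => ?_
          have := (Finset.mem_filter.1 hφ).2
          gcongr
      _ ≤ ∑ φ : ι → σ, Real.exp (l * ∑ b, Z b (φ b)) :=
          Finset.sum_le_sum_of_subset_of_nonneg (Finset.filter_subset _ _)
            fun _ _ _ => (Real.exp_pos _).le
      _ = ∏ b, ∑ s, Real.exp (l * Z b s) := by
          rw [Fintype.prod_sum]
          simp_rw [Finset.mul_sum, Real.exp_sum]
      _ ≤ ∏ _b : ι, (Fintype.card σ * Real.exp (l ^ 2 * D ^ 2)) :=
          Finset.prod_le_prod (fun b _ => Finset.sum_nonneg fun _ _ => (Real.exp_pos _).le)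
            fun b _ => key b
      _ = _ := by
          rw [Finset.prod_const, mul_pow, ← Real.exp_nat_mul, Finset.card_univ, Fintype.card_fun]
          push_cast
          ring_nf
  rw [← le_div_iff₀ (Real.exp_pos _)] at h1
  refine h1.trans (le_of_eq ?_)
  rw [mul_div_assoc, ← Real.exp_sub, mul_comm]
  congr 2
  rw [hl]; field_simp; ring

/-- The hidden set with shifts `φ`: in block `b` of `ZMod m × Fin k`, embedded by `ι` into the ground
set, it consists of the `a` residues `x` for which `x + φ b` lies in `{0, …, a - 1}`. -/
def hiddenSet {α : Type*} {m k : ℕ} [NeZero m] (ι : ZMod m × Fin k ↪ α) (a : ℕ)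
    (φ : Fin k → ZMod m) : Finset α :=
  (Finset.univ.filter fun z : ZMod m × Fin k => (z.1 + φ z.2).val < a).map ι

theorem hiddenSet_subset {α : Type*} {m k : ℕ} [NeZero m] (ι : ZMod m × Fin k ↪ α) (a : ℕ)
    (φ : Fin k → ZMod m) : hiddenSet ι a φ ⊆ Finset.univ.map ι :=
  Finset.map_subset_map.2 (Finset.filter_subset _ _)

section
variable {α : Type*} [DecidableEq α] {m k : ℕ} [NeZero m] (ι : ZMod m × Fin k ↪ α) {a : ℕ}

theorem card_filter_val_lt (ha : a ≤ m) :
    ((Finset.univ : Finset (ZMod m)).filter fun s => s.val < a).card = a := by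
  have : ((Finset.univ : Finset (ZMod m)).filter fun s => s.val < a).card =
      (Finset.range a).card := by
    refine Finset.card_bij (fun s _ => s.val) (by simp) (fun s _ t _ h => ZMod.val_injective m h) ?_
    intro b hb
    have hb' := Finset.mem_range.1 hb
    refine ⟨(b : ZMod m), ?_, ZMod.val_natCast_of_lt (by omega)⟩
    simp [ZMod.val_natCast_of_lt (show b < m by omega), hb']
  simpa using this

theorem sum_ite_val_add_lt (ha : a ≤ m) (x : ZMod m) :
    ∑ s : ZMod m, (if (x + s).val < a then 1 else 0 : ℝ) = a := by
  refine (Equiv.sum_comp (Equiv.addLeft x)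
    (fun s : ZMod m => (if s.val < a then 1 else 0 : ℝ))).trans ?_
  simp [card_filter_val_lt ha]

/-- The size of `Q ∩ ι(P)` as a sum over the blocks. -/
theorem card_inter_map (Q : Finset α) (P : Finset (ZMod m × Fin k)) :
    ((Q ∩ P.map ι).card : ℝ) =
      ∑ b, ∑ x, if ι (x, b) ∈ Q then (if (x, b) ∈ P then 1 else 0 : ℝ) else 0 := by
  have : Q ∩ P.map ι = (Finset.univ.filter fun z => ι z ∈ Q ∧ z ∈ P).map ι := by
    ext y
    simp only [Finset.mem_inter, Finset.mem_map, Finset.mem_filter, Finset.mem_univ, true_and]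
    constructor
    · rintro ⟨hy, z, hz, rfl⟩; exact ⟨z, ⟨hy, hz⟩, rfl⟩
    · rintro ⟨z, ⟨hy, hz⟩, rfl⟩; exact ⟨hy, z, hz, rfl⟩
  rw [this, Finset.card_map, ← Fintype.sum_prod_type_right']
  simp [← ite_and]

theorem card_hiddenSet (ha : a ≤ m) (φ : Fin k → ZMod m) : (hiddenSet ι a φ).card = a * k := by
  have h := card_inter_map ι (hiddenSet ι a φ)
    (Finset.univ.filter fun z : ZMod m × Fin k => (z.1 + φ z.2).val < a)
  rw [← hiddenSet, Finset.inter_self] at h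
  have h2 : ∀ b x, (if ι (x, b) ∈ hiddenSet ι a φ then (if (x, b) ∈
      Finset.univ.filter fun z : ZMod m × Fin k => (z.1 + φ z.2).val < a then 1 else 0 : ℝ) else 0)
      = if (φ b + x).val < a then 1 else 0 := by
    intro b x
    simp [hiddenSet, add_comm]
  simp_rw [h2, sum_ite_val_add_lt ha] at h
  have h3 : ((hiddenSet ι a φ).card : ℝ) = (a * k : ℕ) := by rw [h]; simp [mul_comm]
  exact_mod_cast h3

/-- Few hidden sets meet `Q` in noticeably more than the fraction `a / m` of `Q ∩ M`. -/
theorem card_filter_lt_card_inter_hiddenSet_le (ha : a ≤ m) (Q : Finset α) {θ : ℝ} (hθ : 0 ≤ θ)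
    (hθm : θ ≤ 2 * m) :
    (((Finset.univ : Finset (Fin k → ZMod m)).filter fun φ =>
      θ * k < ((Q ∩ hiddenSet ι a φ).card : ℝ) -
        a / m * (Q ∩ Finset.univ.map ι).card).card : ℝ) ≤
      Real.exp (-(θ ^ 2 / (4 * (m : ℝ) ^ 2)) * k) * Fintype.card (Fin k → ZMod m) := by
  have hm : (0 : ℝ) < m := by exact_mod_cast NeZero.pos m
  have hZ : ∀ φ : Fin k → ZMod m, ((Q ∩ hiddenSet ι a φ).card : ℝ) -
        a / m * (Q ∩ Finset.univ.map ι).card = ∑ b, ∑ x : ZMod m, if ι (x, b) ∈ Q then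
          ((if (x + φ b).val < a then 1 else 0) - a / m : ℝ) else 0 := by
    intro φ
    rw [hiddenSet, card_inter_map, card_inter_map, Finset.mul_sum, ← Finset.sum_sub_distrib]
    refine Finset.sum_congr rfl fun b _ => ?_
    rw [Finset.mul_sum, ← Finset.sum_sub_distrib]
    refine Finset.sum_congr rfl fun x _ => ?_
    by_cases h : ι (x, b) ∈ Q <;> simp [h]
  simp_rw [hZ]
  have := card_lt_sum_le (ι := Fin k) (σ := ZMod m) (Z := fun b s => ∑ x : ZMod m,
    if ι (x, b) ∈ Q then ((if (x + s).val < a then 1 else 0) - a / m : ℝ) else 0) (D := m) (θ := θ)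
    hm hθ hθm ?_ ?_
  · simpa using this
  · intro b
    rw [Finset.sum_comm]
    refine Finset.sum_eq_zero fun x _ => ?_
    by_cases h : ι (x, b) ∈ Q
    · simp only [h, if_true, Finset.sum_sub_distrib, sum_ite_val_add_lt ha]
      simp only [Finset.sum_const, Finset.card_univ, ZMod.card, nsmul_eq_mul]
      field_simp
      simp
    · simp [h]
  · intro b s
    refine (Finset.abs_sum_le_sum_abs _ _).trans ?_
    have h1 : ∀ x : ZMod m, |if ι (x, b) ∈ Q then
        ((if (x + s).val < a then 1 else 0) - a / m : ℝ) else 0| ≤ 1 := by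
      intro x
      have h2 : (a : ℝ) / m ≤ 1 := div_le_one_of_le₀ (by exact_mod_cast ha) hm.le
      have h3 : (0 : ℝ) ≤ a / m := by positivity
      split_ifs <;> rw [abs_le] <;> constructor <;> linarith
    refine (Finset.sum_le_sum fun x _ => h1 x).trans ?_
    simp [ZMod.card]

end

/-- For all but an exponentially small fraction of the hidden sets, `Q` is balanced. -/
theorem card_unbalanced_le {α : Type*} [DecidableEq α] {m k : ℕ} [NeZero m]
    (ι : ZMod m × Fin k ↪ α) {a : ℕ} (ha0 : 0 < a) (ham : a < m) (hk : 0 < k) {η : ℝ}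
    (hη0 : 0 ≤ η) (hη1 : η ≤ 1) (Q : Finset α) :
    (((Finset.univ : Finset (Fin k → ZMod m)).filter fun φ =>
      η < deficit (Finset.univ.map ι \ hiddenSet ι a φ) Q - deficit (hiddenSet ι a φ) Q).card : ℝ) ≤
      Real.exp (-((η * (a * (m - a) / m)) ^ 2 / (4 * (m : ℝ) ^ 2)) * k) *
        Fintype.card (Fin k → ZMod m) := by
  have hm : (0 : ℝ) < m := by exact_mod_cast NeZero.pos m
  have ha : (0 : ℝ) < a := by exact_mod_cast ha0
  have hma : (0 : ℝ) < m - a := sub_pos.2 (by exact_mod_cast ham)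
  have hk' : (0 : ℝ) < k := by exact_mod_cast hk
  have hθ : (a * (m - a) / m : ℝ) ≤ m := by
    rw [div_le_iff₀ hm]; nlinarith
  have hθ0 : 0 ≤ (a * (m - a) / m : ℝ) := by positivity
  refine le_trans ?_ (card_filter_lt_card_inter_hiddenSet_le ι ham.le Q
    (θ := η * (a * (m - a) / m)) (by positivity) (by nlinarith))
  rw [Nat.cast_le]
  refine Finset.card_le_card (Finset.monotone_filter_right _ fun φ _ h => ?_)
  have hsub := hiddenSet_subset ι a φ
  have h1 : ((Q ∩ hiddenSet ι a φ).card : ℝ) +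
      (Q ∩ (Finset.univ.map ι \ hiddenSet ι a φ)).card = (Q ∩ Finset.univ.map ι).card := by
    have h := Finset.card_union_of_disjoint (s := Q ∩ hiddenSet ι a φ)
      (t := Q ∩ (Finset.univ.map ι \ hiddenSet ι a φ))
      (Finset.disjoint_sdiff.mono Finset.inter_subset_right Finset.inter_subset_right)
    rw [← Finset.inter_union_distrib_left, Finset.union_sdiff_of_subset hsub] at h
    exact_mod_cast h.symm
  have h2 : ((hiddenSet ι a φ).card : ℝ) = a * k := by
    rw [card_hiddenSet ι ham.le]; push_cast; ring
  have h3 : ((Finset.univ.map ι \ hiddenSet ι a φ).card : ℝ) = (m - a) * k := by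
    have := Finset.card_sdiff_add_card_eq_card hsub
    have h4 : ((Finset.univ.map ι \ hiddenSet ι a φ).card : ℝ) + (hiddenSet ι a φ).card = m * k := by
      rw [← Nat.cast_add, this]; simp [ZMod.card]
    rw [h2] at h4
    linarith
  unfold deficit at h
  rw [h2, h3] at h
  rw [← h1]
  generalize ((Q ∩ hiddenSet ι a φ).card : ℝ) = i at *
  generalize ((Q ∩ (Finset.univ.map ι \ hiddenSet ι a φ)).card : ℝ) = j at *
  have h5 : η < i / (a * k) - j / ((m - a) * k) := by linarith
  have h6 := mul_lt_mul_of_pos_right h5 (show 0 < a * (m - a) / m * (k : ℝ) by positivity)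
  calc η * (a * (m - a) / m) * k = η * (a * (m - a) / m * (k : ℝ)) := by ring
    _ < _ := h6
    _ = i - a / m * (i + j) := by field_simp; ring

/-! ### Algorithms that cannot distinguish the hidden sets -/

/-- If every single set separates `g` from at most `C` of the functions `F φ`, then a decision tree
that makes `q` queries on `g` ends with a value other than that of its run on `g` for at most
`(q + 1) * C` of the functions: the `q` queries and the output can each reveal at most `C` of them. -/
theorem OracleTree.card_distinguished_le {α Φ : Type*} [Fintype Φ] (F : Φ → Finset α → ℝ)
    (g : Finset α → ℝ) {C : ℝ} (hC : ∀ Q, ((Finset.univ.filter fun φ => F φ Q ≠ g Q).card : ℝ) ≤ C) :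
    ∀ t : OracleTree α, ((Finset.univ.filter fun φ =>
      F φ (t.output (F φ)) ≠ g (t.output g)).card : ℝ) ≤ (t.queryCount g + 1) * C
  | .done S => by
    refine (hC S).trans (le_of_eq ?_)
    simp [OracleTree.queryCount]
  | .query Q next => by
    classical
    have ih := OracleTree.card_distinguished_le F g hC (next (g Q))
    have h : (Finset.univ.filter fun φ =>
        F φ ((OracleTree.query Q next).output (F φ)) ≠ g ((OracleTree.query Q next).output g)) ⊆
        (Finset.univ.filter fun φ => F φ Q ≠ g Q) ∪ Finset.univ.filter fun φ =>
          F φ ((next (g Q)).output (F φ)) ≠ g ((next (g Q)).output g) := by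
      intro φ h
      replace h := (Finset.mem_filter.1 h).2
      rw [Finset.mem_union, Finset.mem_filter, Finset.mem_filter]
      by_cases hQ : F φ Q = g Q
      · rw [OracleTree.output, OracleTree.output, hQ] at h
        exact Or.inr ⟨Finset.mem_univ φ, h⟩
      · exact Or.inl ⟨Finset.mem_univ φ, hQ⟩
    calc _ ≤ ((Finset.univ.filter fun φ => F φ Q ≠ g Q).card : ℝ) + (Finset.univ.filter fun φ =>
          F φ ((next (g Q)).output (F φ)) ≠ g ((next (g Q)).output g)).card := by
          exact_mod_cast (Finset.card_le_card h).trans (Finset.card_union_le _ _)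
      _ ≤ C + ((next (g Q)).queryCount g + 1) * C := add_le_add (hC Q) ih
      _ = _ := by simp only [OracleTree.queryCount]; push_cast; ring

namespace RandomizedAlgorithm
variable {Ω : Type*} [MeasurableSpace Ω]

theorem integrable_value (A : RandomizedAlgorithm Ω) (P : Measure Ω) [IsFiniteMeasure P] (n B : ℕ)
    (f h : Finset (Fin n) → ℝ) : Integrable (fun ω => h ((A.run n B ω).output f)) P := by
  let : MeasurableSpace (Finset (Fin n)) := ⊤
  have h1 : Measurable fun ω => (A.run n B ω).output f :=
    measurable_to_countable' fun S => A.measurable_output n B f S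
  have h2 : Measurable fun ω => h ((A.run n B ω).output f) := (measurable_from_top (f := h)).comp h1
  refine Integrable.of_bound h2.aestronglyMeasurable (∑ S, |h S|) (Eventually.of_forall fun ω => ?_)
  exact Finset.single_le_sum (f := fun S => |h S|) (fun _ _ => abs_nonneg _) (Finset.mem_univ _)

/-- Averaging over the family `F`: if every set separates `g` from at most a fraction `C` of the
functions `F φ`, and `g` is at most `v` on the permitted sets, then an algorithm cannot have an
expected value of more than `v + (q + 1) * C` on all of the functions `F φ`. -/
theorem le_of_indistinguishable (A : RandomizedAlgorithm Ω) (P : Measure Ω) [IsProbabilityMeasure P]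
    {n B : ℕ} {Φ : Type*} [Fintype Φ] [Nonempty Φ] {F : Φ → Finset (Fin n) → ℝ}
    {g : Finset (Fin n) → ℝ} {C v β r : ℝ} {q : ℕ}
    (hC : ∀ Q, ((Finset.univ.filter fun φ => F φ Q ≠ g Q).card : ℝ) ≤ C * Fintype.card Φ)
    (hC0 : 0 ≤ C) (hF : ∀ φ S, F φ S ≤ 1) (hv0 : 0 ≤ v)
    (hg : ∀ S, HasInfeasibilityRatio B S β → g S ≤ v)
    (hq : ∀ᵐ ω ∂P, (A.run n B ω).queryCount g ≤ q)
    (hβ : ∀ᵐ ω ∂P, HasInfeasibilityRatio B ((A.run n B ω).output g) β)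
    (hr : ∀ φ, r ≤ ∫ ω, F φ ((A.run n B ω).output (F φ)) ∂P) :
    r ≤ v + (q + 1) * C := by
  have hN : (0 : ℝ) < Fintype.card Φ := by exact_mod_cast Fintype.card_pos
  have h1 : ∀ᵐ ω ∂P, ∑ φ, F φ ((A.run n B ω).output (F φ)) ≤
      Fintype.card Φ * (v + (q + 1) * C) := by
    filter_upwards [hq, hβ] with ω h1 h2
    have h3 := OracleTree.card_distinguished_le F g hC (A.run n B ω)
    calc ∑ φ, F φ ((A.run n B ω).output (F φ)) ≤ ∑ φ, (v +
          if F φ ((A.run n B ω).output (F φ)) ≠ g ((A.run n B ω).output g) then 1 else 0) := by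
          refine Finset.sum_le_sum fun φ _ => ?_
          split_ifs with h
          · linarith [hF φ ((A.run n B ω).output (F φ))]
          · rw [not_not.1 h, add_zero]; exact hg _ h2
      _ = Fintype.card Φ * v + (Finset.univ.filter fun φ =>
          F φ ((A.run n B ω).output (F φ)) ≠ g ((A.run n B ω).output g)).card := by
          rw [Finset.sum_add_distrib, Finset.sum_boole]; simp
      _ ≤ Fintype.card Φ * v + (q + 1) * (C * Fintype.card Φ) := by
          gcongr
          refine h3.trans ?_
          gcongr
      _ = _ := by ring
  have h2 := integral_mono_ae (integrable_finsetSum Finset.univ fun φ _ =>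
    A.integrable_value P n B (F φ) (F φ)) (integrable_const _) h1
  rw [integral_finsetSum _ fun φ _ => A.integrable_value P n B (F φ) (F φ)] at h2
  have h3 : Fintype.card Φ * r ≤ ∑ φ, ∫ ω, F φ ((A.run n B ω).output (F φ)) ∂P := by
    simpa using Finset.sum_le_sum fun φ (_ : φ ∈ Finset.univ) => hr φ
  have h4 := h3.trans h2
  simp only [integral_const, probReal_univ, one_smul] at h4
  exact le_of_mul_le_mul_left h4 hN

end RandomizedAlgorithm

/-- A subexponential number of queries is outweighed by the exponentially small failure
probability. -/
theorem IsSubexponential.tendsto_mul_exp {q : ℕ → ℕ} (hq : IsSubexponential q) {κ : ℝ} (hκ : 0 < κ)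
    {N : ℕ} (hN : 0 < N) :
    Tendsto (fun k : ℕ => ((q (N * k) : ℝ) + 1) * Real.exp (-κ * k)) atTop (nhds 0) := by
  have hN' : (0 : ℝ) < N := by exact_mod_cast hN
  have hNk : Tendsto (fun k : ℕ => N * k) atTop atTop :=
    tendsto_id.const_mul_atTop' hN
  have h1 : Tendsto (fun k : ℕ => 2 * Real.exp (-(κ / 2 * k))) atTop (nhds 0) := by
    have h := (Real.tendsto_exp_neg_atTop_nhds_zero.comp
      (tendsto_natCast_atTop_atTop.const_mul_atTop (half_pos hκ))).const_mul 2
    rw [mul_zero] at h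
    exact h
  refine squeeze_zero' (Eventually.of_forall fun k => by positivity) ?_ h1
  filter_upwards [hNk.eventually (hq (κ / (2 * N)) (by positivity))] with k hk
  have h2 : κ / (2 * N) * ((N * k : ℕ) : ℝ) = κ / 2 * k := by push_cast; field_simp
  rw [h2] at hk
  have h3 : 1 ≤ Real.exp (κ / 2 * k) := Real.one_le_exp (by positivity)
  calc ((q (N * k) : ℝ) + 1) * Real.exp (-κ * k) ≤ (2 * Real.exp (κ / 2 * k)) * Real.exp (-κ * k) := by
        gcongr; linarith
    _ = 2 * Real.exp (-(κ / 2 * k)) := by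
        rw [mul_assoc, ← Real.exp_add]; congr 2; ring

/-- The hardness result for a general splitting of the ground set. For ground sets of size `N * k`,
the part `M` has `m * k` elements, of which `a * k` are hidden, and `L` has the other `(N - m) * k`
elements. In the hypothesis `hv`, the variables `x` and `y` stand for `|S ∩ M| / k` and
`|S ∩ L| / k`, and the left-hand side is the value of a balanced set `S`. -/
theorem RandomizedAlgorithm.le_of_guaranteesBicriteria {Ω : Type*} [MeasurableSpace Ω]
    (P : Measure Ω) [IsProbabilityMeasure P] (A : RandomizedAlgorithm Ω) {c : ℚ} {β r v w ν : ℝ}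
    {a m N : ℕ} (ha : 0 < a) (ham : 2 * a ≤ m) (hmN : m ≤ N) (hc : ((a + (N - m) : ℕ) : ℚ) / N = c)
    (hw0 : 0 ≤ w) (hw1 : w ≤ 1) (hν0 : 0 ≤ ν) (hν : ν * ((N - m : ℕ) : ℝ) = 1 - w)
    (hv0 : 0 ≤ v) (hr0 : 0 ≤ r)
    (hv : ∀ x y : ℝ, 0 ≤ x → x ≤ m → 0 ≤ y → x + y ≤ β * (a + (N - m) : ℕ) →
      w * (1 - (1 - x / m) * (1 - x / m) ^ ((1 - (a / m : ℝ)) / (a / m))) + ν * y ≤ v)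
    (hq : A.UsesSubexponentiallyManyQueries P c) (hA : A.GuaranteesBicriteria P c r β) :
    r ≤ v := by
  obtain ⟨q, hqs, hq⟩ := hq
  have hm0 : 0 < m := by omega
  have : NeZero m := ⟨hm0.ne'⟩
  have ham' : a < m := by omega
  have hm' : (0 : ℝ) < m := by exact_mod_cast hm0
  have ha' : (0 : ℝ) < a := by exact_mod_cast ha
  have hma : (0 : ℝ) < m - a := sub_pos.2 (by exact_mod_cast ham')
  set p : ℝ := a / m with hp
  have hp0 : 0 < p := by positivity
  have hp2 : p ≤ 1 / 2 := by
    rw [hp, div_le_iff₀ hm']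
    have : (2 : ℝ) * a ≤ m := by exact_mod_cast ham
    linarith
  -- The optimal value of the hidden instances is `1 - η` only, so `η` has to tend to `0`.
  suffices H : ∀ η : ℝ, 0 < η → η ≤ 1 → r * (1 - η) ≤ v by
    have h1 : Tendsto (fun η : ℝ => r * (1 - η)) (nhdsWithin 0 (Set.Ioi 0)) (nhds r) := by
      have : ContinuousAt (fun η : ℝ => r * (1 - η)) 0 := by fun_prop
      simpa using this.tendsto.mono_left nhdsWithin_le_nhds
    refine le_of_tendsto h1 ?_
    filter_upwards [Ioc_mem_nhdsGT (zero_lt_one (α := ℝ))] with η hη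
    exact H η hη.1 hη.2
  intro η hη0 hη1
  have hκ : 0 < (η * (a * (m - a) / m)) ^ 2 / (4 * (m : ℝ) ^ 2) := by positivity
  set κ := (η * (a * (m - a) / m)) ^ 2 / (4 * (m : ℝ) ^ 2)
  have hlim := (hqs.tendsto_mul_exp hκ (hm0.trans_le hmN)).const_add v
  rw [add_zero] at hlim
  refine ge_of_tendsto hlim ?_
  filter_upwards [eventually_gt_atTop 0] with k hk
  have hk' : (0 : ℝ) < k := by exact_mod_cast hk
  have hN0 : 0 < N := hm0.trans_le hmN
  have hcard : Fintype.card (ZMod m × Fin k) ≤ Fintype.card (Fin (N * k)) := by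
    simpa [ZMod.card] using Nat.mul_le_mul_right k hmN
  obtain ⟨ι⟩ := Function.Embedding.nonempty_of_card_le hcard
  set M := (Finset.univ : Finset (ZMod m × Fin k)).map ι with hM
  have hMcard : M.card = m * k := by simp [hM, ZMod.card]
  have hLcard : Mᶜ.card = (N - m) * k := by
    rw [Finset.card_compl, hMcard, Fintype.card_fin, Nat.sub_mul]
  have hLν : ν / k * (Mᶜ.card : ℝ) = 1 - w := by
    rw [hLcard, ← hν]; push_cast; field_simp
  have hB : (((a + (N - m)) * k : ℕ) : ℚ) / (N * k : ℕ) = c := by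
    rw [← hc]
    have : (k : ℚ) ≠ 0 := by exact_mod_cast hk.ne'
    push_cast
    exact mul_div_mul_right _ _ this
  set B := (a + (N - m)) * k with hBdef
  have hS : ∀ φ, (hiddenSet ι a φ).Nonempty := fun φ => by
    rw [← Finset.card_pos, card_hiddenSet ι ham'.le]; positivity
  have hSM : ∀ φ, (M \ hiddenSet ι a φ).Nonempty := fun φ => by
    rw [← Finset.card_pos, Finset.card_sdiff_of_subset (hiddenSet_subset ι a φ),
      card_hiddenSet ι ham'.le, ← hM, hMcard, ← Nat.sub_mul]
    exact Nat.mul_pos (by omega) hk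
  have hpM : ∀ φ, p * (M.card : ℝ) = (hiddenSet ι a φ).card := fun φ => by
    rw [hMcard, card_hiddenSet ι ham'.le, hp]; push_cast; field_simp
  let F : (Fin k → ZMod m) → Finset (Fin (N * k)) → ℝ := fun φ =>
    hardFun p η w (ν / k) M (hiddenSet ι a φ) Mᶜ
  let g : Finset (Fin (N * k)) → ℝ := fun S =>
    w * (1 - deficit M S * deficit M S ^ ((1 - p) / p)) + ν / k * (S ∩ Mᶜ).card
  have hνk : 0 ≤ ν / k := by positivity
  have hFobj : ∀ φ, IsObjective (F φ) := fun φ =>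
    isObjective_hardFun hp0 hp2 hη0.le hw0 hνk _ _ _
  have hgobj : IsObjective g := by
    -- Every set is balanced at tolerance `1`, so `g` is itself one of the functions `hardFun`.
    have : g = hardFun p 1 w (ν / k) M (hiddenSet ι a 0) Mᶜ := by
      funext S
      refine (hardFun_of_balanced hp0 hp2 (hiddenSet_subset ι a 0) (hS 0) (hSM 0) (hpM 0) ?_).symm
      linarith [deficit_le_one (M \ hiddenSet ι a 0) S, deficit_nonneg (hiddenSet ι a 0) S]
    rw [this]
    exact isObjective_hardFun hp0 hp2 zero_le_one hw0 hνk _ _ _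
  refine A.le_of_indistinguishable P (n := N * k) (B := B) (F := F) (g := g) (β := β) ?_
    (Real.exp_pos _).le (fun φ S => hardFun_le_one hp0 hp2 hη0.le hw0 hνk hLν S) hv0 ?_
    (hq _ _ hB g hgobj) (hA _ _ hB g hgobj).1 ?_
  · intro Q
    refine le_trans ?_ (card_unbalanced_le ι ha ham' hk hη0.le hη1 Q)
    rw [Nat.cast_le]
    refine Finset.card_le_card (Finset.monotone_filter_right _ fun φ _ h => ?_)
    by_contra h'
    exact h (hardFun_of_balanced hp0 hp2 (hiddenSet_subset ι a φ) (hS φ) (hSM φ) (hpM φ)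
      (not_lt.1 h'))
  · intro S hSβ
    have h1 : (S.card : ℝ) = (S ∩ M).card + (S ∩ Mᶜ).card := by
      rw [← Finset.sdiff_eq_inter_compl]
      exact_mod_cast (Finset.card_inter_add_card_sdiff S M).symm
    have h2 : ((S ∩ M).card : ℝ) ≤ m * k := by
      have := Finset.card_le_card (Finset.inter_subset_right (s₁ := S) (s₂ := M))
      rw [hMcard] at this
      exact_mod_cast this
    unfold HasInfeasibilityRatio at hSβ
    have h3 := hv ((S ∩ M).card / k) ((S ∩ Mᶜ).card / k) (by positivity)
      (by rwa [div_le_iff₀ hk']) (by positivity) (by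
        rw [← add_div, ← h1, div_le_iff₀ hk']
        refine hSβ.trans (le_of_eq ?_)
        rw [hBdef]; push_cast; ring)
    have h4 : deficit M S = 1 - (S ∩ M).card / k / m := by
      rw [deficit, hMcard]; push_cast; rw [div_div, mul_comm (k : ℝ)]
    refine le_trans (le_of_eq ?_) h3
    simp only [g, h4]
    ring
  · intro φ
    refine le_trans ?_ (hA _ _ hB (F φ) (hFobj φ)).2
    have hdisj : Disjoint M Mᶜ := disjoint_compl_right
    have h1 : (hiddenSet ι a φ ∪ Mᶜ).card ≤ B :=
      (Finset.card_union_le _ _).trans (by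
        rw [card_hiddenSet ι ham'.le, hLcard, hBdef, Nat.add_mul])
    have h2 : F φ (hiddenSet ι a φ ∪ Mᶜ) ≤ optValue (F φ) B :=
      Finset.le_sup' (F φ) (by simpa using h1)
    have h3 : 1 - η ≤ F φ (hiddenSet ι a φ ∪ Mᶜ) :=
      one_sub_le_hardFun hp0 hp2 hη0.le hw0 hw1 hLν hdisj (hS φ)
    gcongr
    exact h3.trans h2

theorem mainTheorem2 (c : ℚ) (hc0 : 0 < c) (hc1 : c < 1) (ε : ℝ) (hε0 : 0 < ε) (hε1 : ε < 1)
    (δ : ℝ) (hδ0 : 0 < δ) (hδε : δ ≤ ε)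
    {Ω : Type*} [MeasurableSpace Ω] (P : Measure Ω) [IsProbabilityMeasure P]
    (A : RandomizedAlgorithm Ω) :
    ¬ (A.UsesSubexponentiallyManyQueries P c ∧
        A.GuaranteesBicriteria P c (1 - ε + δ) (rho (c : ℝ) ε)) := by
  rintro ⟨hq, hA⟩
  suffices h : 1 - ε + δ ≤ 1 - ε by linarith
  obtain ⟨b, hb⟩ := Int.eq_ofNat_of_zero_le (Rat.num_nonneg.2 hc0.le)
  have hcb : (b : ℚ) / c.den = c := by
    have h := Rat.num_div_den c
    rw [hb] at h
    simpa only [Int.ofNat_eq_natCast, Int.cast_natCast] using h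
  have hcR : (c : ℝ) = b / c.den := by
    have h := congrArg (Rat.cast : ℚ → ℝ) hcb
    push_cast at h
    exact h.symm
  have hd : 0 < c.den := c.den_pos
  generalize c.den = d at hcb hcR hd
  have hd' : (0 : ℝ) < d := by exact_mod_cast hd
  have hcR0 : (0 : ℝ) < c := by exact_mod_cast hc0
  have hcR1 : (c : ℝ) < 1 := by exact_mod_cast hc1
  have hbd : (b : ℝ) = c * d := by rw [hcR]; field_simp
  have hb0 : 0 < b := by
    have : (0 : ℝ) < b := by rw [hbd]; positivity
    exact_mod_cast this
  rcases le_or_gt (c : ℝ) (1 / 2) with hc | hc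
  · have h2b : 2 * b ≤ d := by
      have : (2 : ℝ) * b ≤ d := by rw [hbd]; nlinarith
      exact_mod_cast this
    refine A.le_of_guaranteesBicriteria P (w := 1) (ν := 0) hb0 h2b le_rfl (by simpa using hcb)
      zero_le_one le_rfl le_rfl (by simp) (by linarith) (by linarith) ?_ hq hA
    intro x y hx hxd hy hxy
    rw [← hcR]
    have h1 : ε ^ (c : ℝ) ≤ 1 - x / d := by
      rw [rho, if_pos hc, Nat.sub_self, add_zero, hbd, ← mul_assoc, div_mul_cancel₀ _ hcR0.ne'] at hxy
      have : x / d ≤ 1 - ε ^ (c : ℝ) := by rw [div_le_iff₀ hd']; linarith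
      linarith
    have h2 : 0 < ε ^ (c : ℝ) := Real.rpow_pos_of_pos hε0 _
    have h3 : ε = ε ^ (c : ℝ) * (ε ^ (c : ℝ)) ^ ((1 - (c : ℝ)) / c) := by
      rw [← Real.rpow_mul hε0.le, ← Real.rpow_add hε0, mul_div_cancel₀ _ hcR0.ne',
        add_sub_cancel, Real.rpow_one]
    have h4 : ε ^ (c : ℝ) * (ε ^ (c : ℝ)) ^ ((1 - (c : ℝ)) / c) ≤
        (1 - x / d) * (1 - x / d) ^ ((1 - (c : ℝ)) / c) := by
      have : 0 ≤ (1 - (c : ℝ)) / c := div_nonneg (by linarith) hcR0.le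
      have := h2.le.trans h1
      gcongr
    linarith
  · have hbd1 : b < d := by
      have : (b : ℝ) < d := by rw [hbd]; nlinarith
      exact_mod_cast this
    have hbd2 : d < 2 * b := by
      have : (d : ℝ) < 2 * b := by rw [hbd]; nlinarith
      exact_mod_cast this
    obtain ⟨a, rfl⟩ : ∃ a, d = b + a := ⟨d - b, by omega⟩
    obtain ⟨l, rfl⟩ : ∃ l, b = a + l := ⟨b - a, by omega⟩
    have ha0 : 0 < a := by omega
    have hl0 : 0 < l := by omega
    have ha' : (0 : ℝ) < a := by exact_mod_cast ha0
    have hl' : (0 : ℝ) < l := by exact_mod_cast hl0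
    have e1 : a + l + a - 2 * a = l := by omega
    set s := Real.sqrt ε with hs
    have hs0 : 0 < s := Real.sqrt_pos.2 hε0
    have hss : ε = s ^ 2 := (Real.sq_sqrt hε0.le).symm
    -- Here `|M| = 2 * a * k` and `|L| = l * k`. At `t = s` an element of `M` adds
    -- `w * 2 * s / (2 * a * k)` and an element of `L` adds `(1 - w) / (l * k)`; this `w` makes
    -- the two equal.
    set w : ℝ := a / (a + s * l) with hw
    have hden : 0 < a + s * l := by positivity
    refine A.le_of_guaranteesBicriteria P (w := w) (ν := s / (a + s * l)) (a := a) (m := 2 * a)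
      (N := a + l + a) ha0 le_rfl (by omega) (by rw [e1]; exact hcb) (by positivity)
      (div_le_one_of_le₀ (by nlinarith) hden.le) (by positivity)
      (by rw [e1, hw]; field_simp; ring) (by linarith) (by linarith) ?_ hq hA
    intro x y hx hxd hy hxy
    have e2 : (1 - (a / (2 * a : ℕ) : ℝ)) / (a / (2 * a : ℕ)) = 1 := by
      push_cast; field_simp; norm_num
    rw [e1, rho, if_neg (not_le.2 hc), hcR, ← hs, hss] at hxy
    rw [e2, Real.rpow_one, hss]
    push_cast at hxy ⊢
    have e3 : x + y ≤ 2 * a + l - 2 * a * s - s ^ 2 * l := by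
      refine hxy.trans (le_of_eq ?_)
      field_simp
      ring
    -- The tangent to `t ↦ t ^ 2` at `t = s`.
    have e4 : 0 ≤ (1 - x / (2 * a) - s) ^ 2 := sq_nonneg _
    have e5 : w * (1 - (1 - x / (2 * a)) * (1 - x / (2 * a))) + s / (a + s * l) * y ≤
        w * (1 - (2 * s * (1 - x / (2 * a)) - s ^ 2)) + s / (a + s * l) * y := by
      have : 0 ≤ w := by positivity
      gcongr
      linarith
    refine e5.trans ?_
    have e6 : w * (1 - (2 * s * (1 - x / (2 * a)) - s ^ 2)) + s / (a + s * l) * y =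
        (a * (1 - 2 * s + s ^ 2) + s * (x + y)) / (a + s * l) := by
      rw [hw]; field_simp; ring
    rw [e6, div_le_iff₀ hden]
    nlinarith
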